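/- An \emph{online Turing machine} has a finite set of states, a finite work alphabet, a read-only input tape holding a word over $\{0,1\}$ followed by blanks, and one read/write work tape. In each step its input head stays put, moves one cell to the right, or returns to the beginning of the input (which starts a new pass); the work head moves freely. A nondeterministic machine accepts $x$ if some sequence of nondeterministic choices makes it halt in an accepting state. The machine makes at most $p(n)$ passes and uses space $s(n)$ if, on every input of length $n$ and for all nondeterministic choices, it begins at most $p(n)$ passes (counting the first) and its work head visits at most $s(n)$ cells (counting the initial one). For a language $L\subseteq\{0,1\}^*$ let $P(L(n))\subseteq\mathbb{R}^n$ be the convex hull of the words of length $n$ in $L$, viewed as $0/1$ vectors. The extension complexity $\mathrm{xc}(P)$ of a polytope $P$ is the smallest number of linear inequalities defining a polytope $Q$ (in some $\mathbb{R}^k$) of which $P$ is a projection, that is, the image under an affine map. We write $\mathrm{xc}(L)=2^{O(f(n))}\,n$ if there are constants $C,n_0$ such that $\mathrm{xc}(P(L(n)))\le 2^{C f(n)}\,n$ for all $n\ge n_0$. \textbf{Theorem.} (1) If $L\subseteq\{0,1\}^*$ is accepted by a nondeterministic online Turing machine that makes at most $p(n)$ passes and uses space $s(n)$, then $\mathrm{xc}(L)=2^{O(p(n)s(n))}\,n$.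 (2) Let $(M_n)_{n\in\mathbb{N}}$ be a (not necessarily uniform) family of deterministic online Turing machines such that $M_n$, on inputs of length $n$, makes at most $p(n)$ passes and uses space $s(n)$. Assume that the work alphabets of the $M_n$ have bounded size and that $M_n$ has at most $2^{O(s(n))}$ states (that is, the control state of $M_n$ can be stored in $O(s(n))$ bits). Then the language $L=\{x : M_{|x|}\text{ accepts }x\}$ satisfies $\mathrm{xc}(L)=2^{O(p(n)s(n))}\,n$. -/

import Mathlib

/-- What the input head does in a step: stay put, move one cell to the right, or return to the
beginning of the input, which starts a new pass. It can never move to the left. -/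
inductive InputMove where
  | stay
  | right
  | rewind

/-- What the work head does in a step. -/
inductive WorkMove where
  | left
  | stay
  | right

/-- A (multi-pass, in general nondeterministic) online Turing machine with a read-only input tape
over `{0,1}` and one read/write work tape. In a transition the machine sees its state, the scanned
input symbol (`none` when the head has passed the end of the input) and the scanned work symbol;
`trans` is the set of its possible reactions: the new state, the symbol written on the work tape,
and the moves of the two heads. -/
structure OnlineTM where
  State : Type
  Sym : Type
  finite_state : Finite State
  finite_sym : Finite Sym
  blank : Sym
  start : State
  accepting : Set State
  trans : State → Option Bool → Sym → Set (State × Sym × InputMove × WorkMove)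

namespace OnlineTM

/-- A configuration: the control state, the part of the input from the input head onwards,
the content of the (one-way infinite) work tape, the position of the work head, and the number of
passes begun so far. -/
structure Config (M : OnlineTM) where
  state : M.State
  rest : List Bool
  work : ℕ → M.Sym
  head : ℕ
  pass : ℕ

variable (M : OnlineTM)

/-- The initial configuration on input `x`: blank work tape, both heads at the left end, and the
first pass begun. -/
def init (x : List Bool) : M.Config where
  state := M.start
  rest := x
  work := fun _ => M.blank
  head := 0
  pass := 1

/-- The set of reactions available in a configuration. -/
def options (c : M.Config) : Set (M.State × M.Sym × InputMove × WorkMove) :=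
  M.trans c.state c.rest.head? (c.work c.head)

/-- The unread input after an input move, where `x` is the whole input. -/
def moveInput (x rest : List Bool) : InputMove → List Bool
  | .stay => rest
  | .right => rest.tail
  | .rewind => x

/-- The position of the work head after a move; a left move at the left end has no effect. -/
def moveWork (h : ℕ) : WorkMove → ℕ
  | .left => h - 1
  | .stay => h
  | .right => h + 1

/-- The number of passes begun after an input move. -/
def movePass (k : ℕ) : InputMove → ℕ
  | .stay => k
  | .right => k
  | .rewind => k + 1

/-- `M.Step x c c'`: on input `x`, the machine can go from `c` to `c'` in one transition. -/
def Step (x : List Bool) (c c' : M.Config) : Prop :=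
  ∃ q g i w, (q, g, i, w) ∈ M.options c ∧
    c' = { state := q
           rest := moveInput x c.rest i
           work := Function.update c.work c.head g
           head := moveWork c.head w
           pass := movePass c.pass i }

/-- `c` occurs in some computation of `M` on input `x`. -/
def Reachable (x : List Bool) (c : M.Config) : Prop :=
  Relation.ReflTransGen (M.Step x) (M.init x) c

/-- `M` accepts `x`: some sequence of nondeterministic choices makes `M` halt (no transition is
available) in an accepting state. -/
def Accepts (x : List Bool) : Prop :=
  ∃ c, M.Reachable x c ∧ M.options c = ∅ ∧ c.state ∈ M.accepting

/-- On all inputs of length `n` and for all nondeterministic choices, `M` makes at most `p` passes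
over the input and uses at most `s` cells of the work tape (the cells `0, …, s - 1`). -/
def RunsWithin (n p s : ℕ) : Prop :=
  ∀ x : List Bool, x.length = n → ∀ c, M.Reachable x c → c.pass ≤ p ∧ c.head < s

/-- `M` is deterministic: there is never more than one possible reaction. -/
def IsDeterministic : Prop :=
  ∀ q a g, (M.trans q a g).Subsingleton

end OnlineTM

/-- The languages accepted by `p(n)`-pass nondeterministic online Turing machines using
space `s(n)`. -/
def OnlineNSPACE (p s : ℕ → ℕ) : Set (Language Bool) :=
  {L | ∃ M : OnlineTM, (∀ n, M.RunsWithin n (p n) (s n)) ∧ ∀ x, x ∈ L ↔ M.Accepts x}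

/-- The language accepted by a family of machines, the `n`-th of which handles the inputs of
length `n`. -/
def familyLanguage (M : ℕ → OnlineTM) : Language Bool :=
  {x | (M x.length).Accepts x}

/-- The polytope `P(L(n)) ⊆ ℝⁿ`: the convex hull of the words of length `n` in `L`, read as
`0/1` vectors. -/
def langPolytope (L : Language Bool) (n : ℕ) : Set (Fin n → ℝ) :=
  convexHull ℝ {v | ∃ b : Fin n → Bool, List.ofFn b ∈ L ∧ v = fun i => if b i then 1 else 0}

/-- The subset of `ℝᵏ` defined by the `m` inequalities `A y ≤ b`. -/
def ineqSet {m k : ℕ} (A : Matrix (Fin m) (Fin k) ℝ) (b : Fin m → ℝ) : Set (Fin k → ℝ) :=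
  {y | ∀ i, (A.mulVec y) i ≤ b i}

/-- `P` is the projection (the image under an affine map) of a polytope that is defined by `m`
linear inequalities. -/
def HasExtendedFormulation {d : ℕ} (P : Set (Fin d → ℝ)) (m : ℕ) : Prop :=
  ∃ (k : ℕ) (A : Matrix (Fin m) (Fin k) ℝ) (b : Fin m → ℝ) (f : (Fin k → ℝ) →ᵃ[ℝ] (Fin d → ℝ)),
    Bornology.IsBounded (ineqSet A b) ∧ f '' ineqSet A b = P

/-- The extension complexity `xc(P)`: the smallest number of inequalities of an extended
formulation of `P` (and `⊤` if there is none). -/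
noncomputable def extensionComplexity {d : ℕ} (P : Set (Fin d → ℝ)) : ℕ∞ :=
  ⨅ (m : ℕ) (_ : HasExtendedFormulation P m), (m : ℕ∞)

/-! In space `s` a machine has `2^O(s)` work configurations, so a single pass is a run of a small
finite automaton in which the moves made on one letter are merged into one transition
(`recognizable_passTo`). Several passes are cut at the rewinds: guess the configuration after the
first rewind, intersect the one-pass language leading to it with the language of the remaining
passes, and take the union over all guesses. Products and disjoint unions of automata give `2^O(ps)`
states (`recognizable_passesTo`).

For an automaton with `N` states, accepted words of length `n` are labels of paths in a graph with
`n` layers of transitions. Nonnegative unit flows in this graph decompose into paths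
(`IsFlow.exists_decomposition`), so the flow polytope projects onto the convex hull of the accepted
words. Flow conservation consists of equations, which cost nothing; only the `O(N² n)` nonnegativity
constraints count. All constants are explicit in a bound on the alphabet and state sizes, so the
estimate holds for each input length separately and covers both parts. -/

/-! ### Nondeterministic finite automata with few states -/

/-- The automaton `A`, started in the state `q`, can accept the word. -/
def NFA.AcceptsWord {σ : Type} (A : NFA Bool σ) : σ → List Bool → Prop
  | q, [] => q ∈ A.accept
  | q, a :: x => ∃ q' ∈ A.step q a, A.AcceptsWord q' x

/-- `L` is the language of a nondeterministic finite automaton with at most `N` states. -/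
def Recognizable (L : Set (List Bool)) (N : ℕ) : Prop :=
  ∃ (σ : Type) (_ : Fintype σ) (A : NFA Bool σ), Fintype.card σ ≤ N ∧
    ∀ x, x ∈ L ↔ ∃ q ∈ A.start, A.AcceptsWord q x

theorem Recognizable.mono {L : Set (List Bool)} {N N' : ℕ} (h : Recognizable L N) (hN : N ≤ N') :
    Recognizable L N' := by
  obtain ⟨σ, i, A, hA, h⟩ := h
  exact ⟨σ, i, A, hA.trans hN, h⟩

theorem Recognizable.inter {L L' : Set (List Bool)} {N N' : ℕ} (h : Recognizable L N)
    (h' : Recognizable L' N') : Recognizable (L ∩ L') (N * N') := by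
  obtain ⟨σ, i, A, hA, h⟩ := h
  obtain ⟨σ', i', A', hA', h'⟩ := h'
  let P : NFA Bool (σ × σ') :=
    { step := fun q a => A.step q.1 a ×ˢ A'.step q.2 a
      start := A.start ×ˢ A'.start
      accept := A.accept ×ˢ A'.accept }
  have key : ∀ (x : List Bool) (q : σ) (q' : σ'),
      P.AcceptsWord (q, q') x ↔ A.AcceptsWord q x ∧ A'.AcceptsWord q' x := by
    intro x
    induction x with
    | nil => intro q q'; rfl
    | cons a x ih =>
      intro q q'
      constructor
      · rintro ⟨⟨r, r'⟩, ⟨hr, hr'⟩, hx⟩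
        obtain ⟨h1, h2⟩ := (ih r r').1 hx
        exact ⟨⟨r, hr, h1⟩, ⟨r', hr', h2⟩⟩
      · rintro ⟨⟨r, hr, h1⟩, ⟨r', hr', h2⟩⟩
        exact ⟨(r, r'), ⟨hr, hr'⟩, (ih r r').2 ⟨h1, h2⟩⟩
  refine ⟨σ × σ', inferInstance, P, ?_, fun x => ?_⟩
  · rw [Fintype.card_prod]
    exact Nat.mul_le_mul hA hA'
  · rw [Set.mem_inter_iff, h, h']
    constructor
    · rintro ⟨⟨q, hq, h1⟩, ⟨q', hq', h2⟩⟩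
      exact ⟨(q, q'), ⟨hq, hq'⟩, (key x q q').2 ⟨h1, h2⟩⟩
    · rintro ⟨⟨q, q'⟩, ⟨hq, hq'⟩, hx⟩
      obtain ⟨h1, h2⟩ := (key x q q').1 hx
      exact ⟨⟨q, hq, h1⟩, ⟨q', hq', h2⟩⟩

theorem Recognizable.iUnion {κ : Type} [Fintype κ] {L : κ → Set (List Bool)} {N : ℕ}
    (h : ∀ k, Recognizable (L k) N) : Recognizable (⋃ k, L k) (Fintype.card κ * N) := by
  choose σ i A hA h using h
  let U : NFA Bool (Σ k, σ k) :=
    { step := fun q a => Sigma.mk q.1 '' (A q.1).step q.2 a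
      start := {q | q.2 ∈ (A q.1).start}
      accept := {q | q.2 ∈ (A q.1).accept} }
  have key : ∀ (x : List Bool) (k : κ) (q : σ k),
      U.AcceptsWord ⟨k, q⟩ x ↔ (A k).AcceptsWord q x := by
    intro x
    induction x with
    | nil => intro k q; rfl
    | cons a x ih =>
      intro k q
      constructor
      · rintro ⟨_, ⟨r, hr, rfl⟩, hx⟩
        exact ⟨r, hr, (ih k r).1 hx⟩
      · rintro ⟨r, hr, hx⟩
        exact ⟨⟨k, r⟩, ⟨r, hr, rfl⟩, (ih k r).2 hx⟩
  refine ⟨Σ k, σ k, inferInstance, U, ?_, fun x => ?_⟩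
  · rw [Fintype.card_sigma]
    exact (Finset.sum_le_card_nsmul _ _ N fun k _ => hA k).trans (by simp)
  · rw [Set.mem_iUnion]
    constructor
    · rintro ⟨k, hk⟩
      obtain ⟨q, hq, hx⟩ := (h k x).1 hk
      exact ⟨⟨k, q⟩, hq, (key x k q).2 hx⟩
    · rintro ⟨⟨k, q⟩, hq, hx⟩
      exact ⟨k, (h k x).2 ⟨q, hq, (key x k q).1 hx⟩⟩

/-! ### Finite control reading the input in several passes -/

section Passes

variable {K : Type} (step : Option Bool → InputMove → K → K → Prop)

/-- From the state `k`, with the word `x` unread, the control can reach within the current pass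
a situation in which `E` holds. -/
inductive PassTo (E : Option Bool → K → Prop) : K → List Bool → Prop
  | event {k x} : E x.head? k → PassTo E k x
  | stay {k k' x} : step x.head? .stay k k' → PassTo E k' x → PassTo E k x
  | right {k k' x} : step x.head? .right k k' → PassTo E k' x.tail → PassTo E k x

/-- From the state `k`, with the word `y` of the input `x` unread, the control can reach a
situation in which `E` holds, returning to the beginning of the input at most `j` times. -/
inductive PassesTo (E : Option Bool → K → Prop) (x : List Bool) : ℕ → K → List Bool → Prop
  | event {j k y} : E y.head? k → PassesTo E x j k y
  | stay {j k k' y} : step y.head? .stay k k' → PassesTo E x j k' y → PassesTo E x j k y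
  | right {j k k' y} : step y.head? .right k k' → PassesTo E x j k' y.tail → PassesTo E x j k y
  | rewind {j k k' y} : step y.head? .rewind k k' → PassesTo E x j k' x →
      PassesTo E x (j + 1) k y

variable {step} {E : Option Bool → K → Prop}

/-- An automaton for the words on which one pass starting in `k₀` leads to `E`. -/
def passNFA (step : Option Bool → InputMove → K → K → Prop) (E : Option Bool → K → Prop)
    (k₀ : K) : NFA Bool (Option K) where
  step q a := {q' | ∀ k, q = some k → ∃ k₁, Relation.ReflTransGen (step (some a) .stay) k k₁ ∧
    ((q' = none ∧ E (some a) k₁) ∨ ∃ k', q' = some k' ∧ step (some a) .right k₁ k')} ∩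
      {q' | q = none → q' = none}
  start := {some k₀}
  accept := {q | ∀ k, q = some k → ∃ k₁,
    Relation.ReflTransGen (fun k k' => step none .stay k k' ∨ step none .right k k') k k₁ ∧
      E none k₁}

/-- `none` is the accepting sink entered once `E` has occurred: all conditions on `some k` are
vacuous there. -/
theorem passNFA_acceptsWord_none (k₀ : K) (x : List Bool) :
    (passNFA step E k₀).AcceptsWord none x := by
  induction x with
  | nil => exact fun k hk => by simp at hk
  | cons a x ih => exact ⟨none, ⟨fun k hk => by simp at hk, fun _ => rfl⟩, ih⟩

/-- Stationary moves on a letter are absorbed into the transition that reads it. Past the end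
`[].tail = []`, so right moves are silent too and are absorbed into acceptance. -/
theorem passNFA_acceptsWord_of_passTo (k₀ : K) {k : K} {x : List Bool} (h : PassTo step E k x) :
    (passNFA step E k₀).AcceptsWord (some k) x := by
  induction h with
  | @event k x hE =>
    cases x with
    | nil => rintro _ ⟨⟩; exact ⟨k, .refl, hE⟩
    | cons a x =>
      refine ⟨none, ⟨?_, fun _ => rfl⟩, passNFA_acceptsWord_none k₀ x⟩
      rintro _ ⟨⟩
      exact ⟨k, .refl, .inl ⟨rfl, hE⟩⟩
  | @stay k k' x hs _ ih =>
    cases x with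
    | nil =>
      rintro _ ⟨⟩
      obtain ⟨k₁, h1, h2⟩ := ih k' rfl
      exact ⟨k₁, .head (.inl hs) h1, h2⟩
    | cons a x =>
      obtain ⟨q, ⟨hq, _⟩, hx⟩ := ih
      refine ⟨q, ⟨?_, fun h => by simp at h⟩, hx⟩
      rintro _ ⟨⟩
      obtain ⟨k₁, h1, h2⟩ := hq k' rfl
      exact ⟨k₁, .head hs h1, h2⟩
  | @right k k' x hs _ ih =>
    cases x with
    | nil =>
      rintro _ ⟨⟩
      obtain ⟨k₁, h1, h2⟩ := ih k' rfl
      exact ⟨k₁, .head (.inr hs) h1, h2⟩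
    | cons a x =>
      refine ⟨some k', ⟨?_, fun h => by simp at h⟩, ih⟩
      rintro _ ⟨⟩
      exact ⟨k, .refl, .inr ⟨k', rfl, hs⟩⟩

theorem passTo_of_passNFA_acceptsWord (k₀ : K) {k : K} {x : List Bool}
    (h : (passNFA step E k₀).AcceptsWord (some k) x) : PassTo step E k x := by
  induction x generalizing k with
  | nil =>
    obtain ⟨k₁, h1, h2⟩ := h k rfl
    clear h
    induction h1 using Relation.ReflTransGen.head_induction_on with
    | refl => exact .event h2
    | head h' _ ih =>
      exact h'.elim (fun h' => .stay h' ih) (fun h' => .right h' ih)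
  | cons a x ih =>
    obtain ⟨q, ⟨hq, _⟩, hx⟩ := h
    obtain ⟨k₁, h1, h2⟩ := hq k rfl
    have h3 : PassTo step E k₁ (a :: x) := by
      rcases h2 with ⟨rfl, h2⟩ | ⟨k', rfl, h2⟩
      · exact .event h2
      · exact .right h2 (ih hx)
    clear h2 hq
    exact Relation.ReflTransGen.head_induction_on
      (motive := fun k _ => PassTo step E k (a :: x)) h1 h3 fun h' _ ih => .stay h' ih

theorem recognizable_passTo [Fintype K] (k : K) :
    Recognizable {x | PassTo step E k x} (Fintype.card K + 1) := by
  refine ⟨Option K, inferInstance, passNFA step E k, by simp, fun x => ?_⟩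
  constructor
  · exact fun h => ⟨some k, rfl, passNFA_acceptsWord_of_passTo k h⟩
  · rintro ⟨_, rfl, h⟩
    exact passTo_of_passNFA_acceptsWord k h

theorem passesTo_of_passTo {x : List Bool} {j : ℕ} {k : K} {y : List Bool}
    (h : PassTo step E k y) : PassesTo step E x j k y := by
  induction h with
  | event h => exact .event h
  | stay h _ ih => exact .stay h ih
  | right h _ ih => exact .right h ih

theorem passesTo_of_passTo_rewind {x : List Bool} {j : ℕ} {k k' : K} {y : List Bool}
    (h : PassTo step (fun a k => step a .rewind k k') k y) (h' : PassesTo step E x j k' x) :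
    PassesTo step E x (j + 1) k y := by
  induction h with
  | event h => exact .rewind h h'
  | stay h _ ih => exact .stay h ih
  | right h _ ih => exact .right h ih

/-- Cut at the first rewind. With its target `k'` fixed, "can rewind into `k'`" is itself an event
of a single pass, and the rest starts afresh on the whole input. -/
theorem PassesTo.exists_first_pass {x : List Bool} {j : ℕ} {k : K} {y : List Bool}
    (h : PassesTo step E x j k y) :
    PassTo step E k y ∨ ∃ i k', j = i + 1 ∧
      PassTo step (fun a k => step a .rewind k k') k y ∧ PassesTo step E x i k' x := by
  induction h with
  | event h => exact .inl (.event h)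
  | stay h _ ih =>
    rcases ih with ih | ⟨i, k', hj, h1, h2⟩
    · exact .inl (.stay h ih)
    · exact .inr ⟨i, k', hj, .stay h h1, h2⟩
  | right h _ ih =>
    rcases ih with ih | ⟨i, k', hj, h1, h2⟩
    · exact .inl (.right h ih)
    · exact .inr ⟨i, k', hj, .right h h1, h2⟩
  | rewind h h' _ => exact .inr ⟨_, _, rfl, .event h, h'⟩

theorem recognizable_passesTo [Fintype K] (j : ℕ) (k : K) :
    Recognizable {x | PassesTo step E x j k x} ((Fintype.card K + 1) ^ (2 * j + 1)) := by
  induction j generalizing k with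
  | zero =>
    have : {x | PassesTo step E x 0 k x} = {x | PassTo step E k x} := by
      ext x
      refine ⟨fun h => ?_, passesTo_of_passTo⟩
      rcases PassesTo.exists_first_pass h with h | ⟨i, _, hi, _⟩
      · exact h
      · simp at hi
    rw [this]
    simpa using recognizable_passTo k
  | succ j ih =>
    -- `none` means no rewind, `some k'` a first rewind into `k'`. The `card K + 1` choices and the
    -- one-pass automaton each contribute a factor `card K + 1`.
    let L : Option K → Set (List Bool) := fun o => o.elim {x | PassTo step E k x}
      fun k' => {x | PassTo step (fun a k => step a .rewind k k') k x} ∩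
        {x | PassesTo step E x j k' x}
    have hL : {x | PassesTo step E x (j + 1) k x} = ⋃ o, L o := by
      ext x
      rw [Set.mem_iUnion]
      constructor
      · intro h
        rcases PassesTo.exists_first_pass h with h | ⟨i, k', hi, h1, h2⟩
        · exact ⟨none, h⟩
        · obtain rfl : j = i := by omega
          exact ⟨some k', h1, h2⟩
      · rintro ⟨_ | k', h⟩
        · exact passesTo_of_passTo h
        · exact passesTo_of_passTo_rewind h.1 h.2
    have hN : ∀ o, Recognizable (L o)
        ((Fintype.card K + 1) * (Fintype.card K + 1) ^ (2 * j + 1)) := by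
      rintro (_ | k')
      · exact (recognizable_passTo k).mono (Nat.le_mul_of_pos_right _ (by positivity))
      · exact (recognizable_passTo k).inter (ih k')
    rw [hL]
    refine (Recognizable.iUnion hN).mono (le_of_eq ?_)
    rw [Fintype.card_option]
    ring

end Passes

/-! ### Online Turing machines as finite controls -/

namespace OnlineTM

/-- The part of a configuration other than the position in the input and the number of passes,
if at most the first `s` cells of the work tape are in use. -/
def WorkConfig (M : OnlineTM) (s : ℕ) : Type :=
  {t : M.State × (ℕ → M.Sym) × ℕ // t.2.2 < s ∧ ∀ i ≥ s, t.2.1 i = M.blank}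

variable {M : OnlineTM} {s : ℕ}

/-- The transition relation on the work configurations. -/
def workStep (a : Option Bool) (i : InputMove) (t t' : M.WorkConfig s) : Prop :=
  ∃ g w, (t'.1.1, g, i, w) ∈ M.trans t.1.1 a (t.1.2.1 t.1.2.2) ∧
    t'.1.2.1 = Function.update t.1.2.1 t.1.2.2 g ∧ t'.1.2.2 = moveWork t.1.2.2 w

/-- The machine halts and accepts. -/
def workAccept (a : Option Bool) (t : M.WorkConfig s) : Prop :=
  M.trans t.1.1 a (t.1.2.1 t.1.2.2) = ∅ ∧ t.1.1 ∈ M.accepting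

/-- The configuration with the given work configuration, unread input and number of passes. -/
def WorkConfig.toConfig (t : M.WorkConfig s) (y : List Bool) (k : ℕ) : M.Config where
  state := t.1.1
  rest := y
  work := t.1.2.1
  head := t.1.2.2
  pass := k

theorem WorkConfig.step_toConfig {x y : List Bool} {i : InputMove} {t t' : M.WorkConfig s}
    (h : workStep y.head? i t t') (k : ℕ) :
    M.Step x (t.toConfig y k) (t'.toConfig (moveInput x y i) (movePass k i)) := by
  obtain ⟨g, w, h1, h2, h3⟩ := h
  refine ⟨t'.1.1, g, i, w, h1, ?_⟩
  simp [WorkConfig.toConfig, h2, h3]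

theorem exists_accepting_of_passesTo {x : List Bool} {j : ℕ} {t : M.WorkConfig s} {y : List Bool}
    (h : PassesTo workStep workAccept x j t y) (k : ℕ) :
    ∃ c, Relation.ReflTransGen (M.Step x) (t.toConfig y k) c ∧ M.options c = ∅ ∧
      c.state ∈ M.accepting := by
  induction h generalizing k with
  | event h => exact ⟨_, .refl, h⟩
  | stay h _ ih =>
    obtain ⟨c, h1, h2⟩ := ih k
    exact ⟨c, .head (WorkConfig.step_toConfig h k) h1, h2⟩
  | right h _ ih =>
    obtain ⟨c, h1, h2⟩ := ih k
    exact ⟨c, .head (WorkConfig.step_toConfig h k) h1, h2⟩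
  | rewind h _ ih =>
    obtain ⟨c, h1, h2⟩ := ih (k + 1)
    exact ⟨c, .head (WorkConfig.step_toConfig h k) h1, h2⟩

/-- Only the scanned cell is ever written, and the head stays below `s`. -/
theorem RunsWithin.work_eq_blank {n p : ℕ} (hM : M.RunsWithin n p s) {x : List Bool}
    (hx : x.length = n) {c : M.Config} (hc : M.Reachable x c) :
    ∀ i ≥ s, c.work i = M.blank := by
  induction hc with
  | refl => exact fun _ _ => rfl
  | tail hc h ih =>
    obtain ⟨q, g, i, w, _, rfl⟩ := h
    intro m hm
    have hne : m ≠ _ := ((hM x hx _ hc).2.trans_le hm).ne'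
    exact (Function.update_of_ne hne g _).trans (ih m hm)

/-- The work configuration of a reachable configuration. -/
def RunsWithin.toWork {n p : ℕ} (hM : M.RunsWithin n p s) {x : List Bool}
    (hx : x.length = n) {c : M.Config} (hc : M.Reachable x c) : M.WorkConfig s :=
  ⟨(c.state, c.work, c.head), (hM x hx c hc).2, hM.work_eq_blank hx hc⟩

theorem RunsWithin.passesTo_of_accepting {n p : ℕ} (hM : M.RunsWithin n p s) {x : List Bool}
    (hx : x.length = n) {c c' : M.Config} (h : Relation.ReflTransGen (M.Step x) c c')
    (h1 : M.options c' = ∅) (h2 : c'.state ∈ M.accepting) (hc : M.Reachable x c) :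
    PassesTo workStep workAccept x (p - c.pass) (hM.toWork hx hc) c.rest := by
  induction h using Relation.ReflTransGen.head_induction_on with
  | refl => exact .event ⟨h1, h2⟩
  | @head c d hs _ ih =>
    have hd : M.Reachable x d := hc.tail hs
    have hp := (hM x hx d hd).1
    have ih := ih hd
    obtain ⟨q, g, i, w, ho, rfl⟩ := hs
    have hw : workStep c.rest.head? i (hM.toWork hx hc) (hM.toWork hx hd) :=
      ⟨g, w, ho, rfl, rfl⟩
    cases i with
    | stay => exact .stay hw ih
    | right => exact .right hw ih
    | rewind =>
      -- The configuration after the rewind is reachable, so its pass count is at most `p` and the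
      -- subtraction does not truncate.
      have : p - c.pass = (p - (c.pass + 1)) + 1 := by
        have : c.pass + 1 ≤ p := hp
        omega
      rw [this]
      exact .rewind hw ih

theorem RunsWithin.accepts_iff {n p : ℕ} (hM : M.RunsWithin n p s) {x : List Bool}
    (hx : x.length = n) (hs : 0 < s) :
    M.Accepts x ↔ PassesTo workStep workAccept x (p - 1)
      (⟨(M.start, fun _ => M.blank, 0), hs, fun _ _ => rfl⟩ : M.WorkConfig s) x := by
  constructor
  · rintro ⟨c, hc, h1, h2⟩
    exact hM.passesTo_of_accepting hx hc h1 h2 .refl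
  · intro h
    obtain ⟨c, h1, h2⟩ := exists_accepting_of_passesTo h 1
    exact ⟨c, h1, h2⟩

theorem WorkConfig.restrict_injective : Function.Injective
    (fun t : M.WorkConfig s => ((t.1.1, (fun i : Fin s => t.1.2.1 i), ⟨t.1.2.2, t.2.1⟩) :
      M.State × (Fin s → M.Sym) × Fin s)) := by
  rintro ⟨⟨q, w, h⟩, h1, h2⟩ ⟨⟨q', w', h'⟩, h1', h2'⟩ heq
  simp only [Prod.mk.injEq, Fin.mk.injEq] at heq
  obtain ⟨rfl, hw, rfl⟩ := heq
  have : w = w' := by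
    funext i
    by_cases hi : i < s
    · exact congrFun hw ⟨i, hi⟩
    · exact (h2 i (not_lt.1 hi)).trans (h2' i (not_lt.1 hi)).symm
  subst this
  rfl

instance : Finite (M.WorkConfig s) :=
  have := M.finite_state
  have := M.finite_sym
  Finite.of_injective _ WorkConfig.restrict_injective

theorem WorkConfig.card_le (M : OnlineTM) (s : ℕ) :
    Nat.card (M.WorkConfig s) ≤ Nat.card M.State * (Nat.card M.Sym ^ s * s) := by
  have := M.finite_state
  have := M.finite_sym
  refine (Nat.card_le_card_of_injective _ WorkConfig.restrict_injective).trans ?_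
  simp [Nat.card_prod, Nat.card_fun]

theorem RunsWithin.recognizable {n p c : ℕ} (hM : M.RunsWithin n p s)
    (hSym : Nat.card M.Sym ≤ c) (hState : Nat.card M.State ≤ 2 ^ (c * s)) :
    0 < p * s ∧ ∃ L, (∀ x : List Bool, x.length = n → (x ∈ L ↔ M.Accepts x)) ∧
      Recognizable L (2 ^ ((4 * c + 4) * (p * s))) := by
  -- The initial configuration alone forces `1 ≤ p` and `0 < s`.
  obtain ⟨hp, hs⟩ := hM (List.replicate n true) (by simp) _ .refl
  replace hp : 1 ≤ p := hp
  replace hs : 0 < s := hs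
  refine ⟨by positivity, _, fun x hx => (hM.accepts_iff hx hs).symm, ?_⟩
  have := Fintype.ofFinite (M.WorkConfig s)
  refine (recognizable_passesTo (p - 1) _).mono ?_
  have hK : Fintype.card (M.WorkConfig s) + 1 ≤ 2 ^ ((2 * c + 2) * s) := by
    rw [← Nat.card_eq_fintype_card]
    have h1 : Nat.card M.Sym ^ s ≤ 2 ^ (c * s) := by
      rw [pow_mul]
      exact Nat.pow_le_pow_left (hSym.trans Nat.lt_two_pow_self.le) s
    have h2 : Nat.card (M.WorkConfig s) ≤ 2 ^ (c * s) * (2 ^ (c * s) * 2 ^ s) :=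
      (WorkConfig.card_le M s).trans
        (Nat.mul_le_mul hState (Nat.mul_le_mul h1 Nat.lt_two_pow_self.le))
    -- The last factor `2 ^ s` is spare, to absorb the `+ 1`.
    have h3 : 2 ^ ((2 * c + 2) * s) = 2 ^ (c * s) * (2 ^ (c * s) * 2 ^ s) * 2 ^ s := by ring
    have h4 : 2 ≤ 2 ^ s := Nat.le_self_pow hs.ne' 2
    have h5 : 0 < 2 ^ (c * s) * (2 ^ (c * s) * 2 ^ s) := by positivity
    rw [h3]
    nlinarith
  calc (Fintype.card (M.WorkConfig s) + 1) ^ (2 * (p - 1) + 1)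
      ≤ (2 ^ ((2 * c + 2) * s)) ^ (2 * p) :=
        (Nat.pow_le_pow_left hK _).trans (Nat.pow_le_pow_right (by positivity) (by omega))
    _ = 2 ^ ((4 * c + 4) * (p * s)) := by
        rw [← pow_mul]
        ring_nf

end OnlineTM

/-! ### Extended formulations from flows -/

/-- Sets cut out of an affine subspace by nonnegativity of finitely many linear functionals. -/
theorem hasExtendedFormulation_of_affineSubspace {V ι : Type} [NormedAddCommGroup V]
    [NormedSpace ℝ V] [FiniteDimensional ℝ V] [Fintype ι] {d : ℕ} {P : Set (Fin d → ℝ)}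
    (H : AffineSubspace ℝ V) (hH : (H : Set V).Nonempty) (l : V →ₗ[ℝ] (ι → ℝ))
    (f : V →ₗ[ℝ] (Fin d → ℝ)) (hb : Bornology.IsBounded {v | v ∈ H ∧ ∀ i, 0 ≤ l v i})
    (hf : f '' {v | v ∈ H ∧ ∀ i, 0 ≤ l v i} = P) :
    HasExtendedFormulation P (Fintype.card ι) := by
  obtain ⟨v₀, hv₀⟩ := hH
  let e := Fintype.equivFin ι
  -- Coordinates on the direction of `H` eliminate the equations, leaving one inequality per
  -- functional.
  let B := Module.finBasis ℝ H.direction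
  let g : (Fin (Module.finrank ℝ H.direction) → ℝ) →ₗ[ℝ] V :=
    H.direction.subtype ∘ₗ B.equivFun.symm.toLinearMap
  have hg : Function.Injective g :=
    (Submodule.injective_subtype _).comp B.equivFun.symm.injective
  let A := LinearMap.toMatrix' (-(LinearMap.funLeft ℝ ℝ e.symm ∘ₗ l ∘ₗ g))
  have himage : (fun z => g z + v₀) '' ineqSet A (fun i => l v₀ (e.symm i)) =
      {v | v ∈ H ∧ ∀ i, 0 ≤ l v i} := by
    have hmem : ∀ z, z ∈ ineqSet A (fun i => l v₀ (e.symm i)) ↔ ∀ i, 0 ≤ l (g z + v₀) i := by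
      intro z
      rw [← e.symm.forall_congr_right]
      refine forall_congr' fun i => ?_
      simp only [A, LinearMap.toMatrix'_mulVec, LinearMap.neg_apply, LinearMap.comp_apply,
        LinearMap.funLeft_apply, Pi.neg_apply, map_add, Pi.add_apply]
      constructor <;> intro h <;> linarith
    ext v
    constructor
    · rintro ⟨z, hz, rfl⟩
      exact ⟨AffineSubspace.vadd_mem_of_mem_direction (B.equivFun.symm z).2 hv₀, (hmem z).1 hz⟩
    · rintro ⟨hv, hl⟩
      have hd : v - v₀ ∈ H.direction := AffineSubspace.vsub_mem_direction hv hv₀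
      have : g (B.equivFun ⟨v - v₀, hd⟩) + v₀ = v := by simp [g]
      refine ⟨B.equivFun ⟨v - v₀, hd⟩, (hmem _).2 ?_, this⟩
      rwa [this]
  refine ⟨_, A, fun i => l v₀ (e.symm i),
    (f ∘ₗ g).toAffineMap + AffineMap.const ℝ _ (f v₀), ?_, ?_⟩
  -- An injective linear map in finite dimension is antilipschitz, so boundedness pulls back.
  · obtain ⟨C, _, hC⟩ := g.exists_antilipschitzWith (LinearMap.ker_eq_bot.2 hg)
    have hC' : AntilipschitzWith C (fun z => g z + v₀) := fun x y => by
      simpa using hC x y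
    refine (hC'.isBounded_preimage hb).subset fun z hz => ?_
    rw [← himage]
    exact ⟨z, hz, rfl⟩
  · rw [← hf, ← himage, Set.image_image]
    refine Set.image_congr fun z _ => ?_
    simp

theorem hasExtendedFormulation_empty (d : ℕ) :
    HasExtendedFormulation (∅ : Set (Fin d → ℝ)) 1 := by
  have : ineqSet (0 : Matrix (Fin 1) (Fin 0) ℝ) (fun _ => -1) = ∅ := by
    ext y
    simp only [ineqSet, Set.mem_ofPred_eq, Set.mem_empty_iff_false, iff_false, not_forall]
    exact ⟨0, by simp⟩
  exact ⟨0, 0, fun _ => -1, AffineMap.const ℝ _ 0, by simp [this], by simp [this]⟩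

namespace NFA

variable {σ : Type} {A : NFA Bool σ}

/-- The words of length `n` that `A` accepts from the state `q`, as `0/1` vectors. -/
def wordVectors (A : NFA Bool σ) (n : ℕ) (q : σ) : Set (Fin n → ℝ) :=
  {v | ∃ b : Fin n → Bool, A.AcceptsWord q (List.ofFn b) ∧ v = fun i => if b i then 1 else 0}

/-- Prepending a fixed letter is an affine map, so it suffices to check words. -/
theorem cons_mem_convexHull_wordVectors {n : ℕ} {q q' : σ} {a : Bool} (h : q' ∈ A.step q a)
    {v : Fin n → ℝ} (hv : v ∈ convexHull ℝ (A.wordVectors n q')) :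
    (Fin.cons (if a then 1 else 0) v : Fin (n + 1) → ℝ) ∈
      convexHull ℝ (A.wordVectors (n + 1) q) := by
  set z : ℝ := if a then 1 else 0 with hz
  have hconv : Convex ℝ {v : Fin n → ℝ | (Fin.cons z v : Fin (n + 1) → ℝ) ∈
      convexHull ℝ (A.wordVectors (n + 1) q)} := by
    intro u hu w hw r t hr ht hrt
    have : (Fin.cons z (r • u + t • w) : Fin (n + 1) → ℝ) =
        r • Fin.cons z u + t • Fin.cons z w := by
      funext i
      refine Fin.cases ?_ (fun i => ?_) i
      · simp [← add_mul, hrt]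
      · simp
    rw [Set.mem_ofPred_eq, this]
    exact convex_convexHull ℝ _ hu hw hr ht hrt
  refine convexHull_min ?_ hconv hv
  rintro _ ⟨b, hb, rfl⟩
  refine subset_convexHull ℝ _ ⟨Fin.cons a b, ?_, ?_⟩
  · rw [List.ofFn_succ]
    exact ⟨q', h, hb⟩
  · funext i
    refine Fin.cases ?_ (fun i => ?_) i <;> simp [hz]

variable [Fintype σ]

/-- The linear equations of a flow through `n` layers of transitions of `A` that enters at the
states with the amounts `α` and leaves at accepting states. -/
def IsFlow (A : NFA Bool σ) : (n : ℕ) → (σ → ℝ) → (Fin n → σ × Bool × σ → ℝ) → Prop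
  | 0, α, _ => ∀ q, q ∉ A.accept → α q = 0
  | n + 1, α, y => (∀ q a q', q' ∉ A.step q a → y 0 (q, a, q') = 0) ∧
      (∀ q, ∑ t : Bool × σ, y 0 (q, t) = α q) ∧
      A.IsFlow n (fun q' => ∑ q, ∑ a, y 0 (q, a, q')) (Fin.tail y)

/-- The value at each position of the input of a flow: the amount passing through the transitions
labelled `1`. -/
def flowValue (n : ℕ) : (Fin n → σ × Bool × σ → ℝ) →ₗ[ℝ] (Fin n → ℝ) where
  toFun y i := ∑ q, ∑ q', y i (q, true, q')
  map_add' y z := by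
    ext i
    simp [Finset.sum_add_distrib]
  map_smul' c y := by
    ext i
    simp [Finset.mul_sum]

/-- The closure property that makes the flows an `AffineSubspace`. -/
theorem IsFlow.combo {n : ℕ} (c : ℝ) {α β γ : σ → ℝ} {x y z : Fin n → σ × Bool × σ → ℝ}
    (hx : A.IsFlow n α x) (hy : A.IsFlow n β y) (hz : A.IsFlow n γ z) :
    A.IsFlow n (c • (α - β) + γ) (c • (x - y) + z) := by
  induction n generalizing α β γ with
  | zero =>
    intro q hq
    simp [hx q hq, hy q hq, hz q hq]
  | succ n ih =>
    obtain ⟨hx1, hx2, hx3⟩ := hx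
    obtain ⟨hy1, hy2, hy3⟩ := hy
    obtain ⟨hz1, hz2, hz3⟩ := hz
    refine ⟨fun q a q' h => ?_, fun q => ?_, ?_⟩
    · simp [hx1 q a q' h, hy1 q a q' h, hz1 q a q' h]
    · simp [Finset.sum_add_distrib, ← Finset.mul_sum, Finset.sum_sub_distrib, hx2, hy2, hz2]
    · convert ih hx3 hy3 hz3 using 1
      · funext q'
        simp [Finset.sum_add_distrib, ← Finset.mul_sum, Finset.sum_sub_distrib]
      · rfl

/-- By conservation every layer carries the total amount `∑ q, α q`. This bounds the flow polytope.
-/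
theorem IsFlow.le_sum {n : ℕ} {α : σ → ℝ} {y : Fin n → σ × Bool × σ → ℝ} (h : A.IsFlow n α y)
    (hy : ∀ i t, 0 ≤ y i t) (i : Fin n) (t : σ × Bool × σ) : y i t ≤ ∑ q, α q := by
  induction n generalizing α with
  | zero => exact i.elim0
  | succ n ih =>
    obtain ⟨_, h2, h3⟩ := h
    have hsum : ∑ t, y 0 t = ∑ q, α q := by
      rw [Fintype.sum_prod_type]
      exact Finset.sum_congr rfl fun q _ => h2 q
    refine Fin.cases ?_ (fun i => ?_) i
    · rw [← hsum]
      exact Finset.single_le_sum (fun t _ => hy 0 t) (Finset.mem_univ t)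
    · refine (ih h3 (fun i t => hy i.succ t) i).trans (le_of_eq ?_)
      rw [← hsum, Fintype.sum_prod_type, Finset.sum_comm]
      refine Finset.sum_congr rfl fun q _ => ?_
      rw [Fintype.sum_prod_type, Finset.sum_comm]

/-- The flow is the indicator of an accepting run. -/
theorem exists_isFlow_of_acceptsWord [DecidableEq σ] {n : ℕ} {q : σ} {b : Fin n → Bool}
    (h : A.AcceptsWord q (List.ofFn b)) :
    ∃ y, A.IsFlow n (Pi.single q 1) y ∧ (∀ i t, 0 ≤ y i t) ∧
      flowValue n y = fun i => if b i then 1 else 0 := by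
  induction n generalizing q with
  | zero =>
    refine ⟨fun i => i.elim0, fun r hr => ?_, fun i => i.elim0, Subsingleton.elim _ _⟩
    have hq : q ∈ A.accept := by simpa [AcceptsWord] using h
    exact Pi.single_eq_of_ne (ne_of_mem_of_not_mem hq hr).symm 1
  | succ n ih =>
    rw [List.ofFn_succ] at h
    obtain ⟨q', hq', h⟩ := h
    obtain ⟨y, h1, h2, h3⟩ := ih h
    refine ⟨Fin.cons (Pi.single (q, b 0, q') 1) y, ⟨?_, ?_, ?_⟩, ?_, ?_⟩
    · intro r a r' hr
      rw [Fin.cons_zero, Pi.single_apply, if_neg]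
      rintro ⟨⟩
      exact hr hq'
    · intro r
      simp only [Fin.cons_zero, Pi.single_apply, Prod.mk.injEq]
      by_cases hr : r = q <;> simp [hr]
    · rw [Fin.tail_cons]
      convert h1 using 1
      funext r'
      simp only [Fin.cons_zero, Pi.single_apply, Prod.mk.injEq, ite_and]
      simp
    · intro i t
      refine Fin.cases ?_ (fun i => ?_) i
      · rw [Fin.cons_zero, Pi.single_apply]
        split_ifs <;> simp
      · exact h2 i t
    · funext i
      refine Fin.cases ?_ (fun i => ?_) i
      · simp only [flowValue, LinearMap.coe_mk, AddHom.coe_mk, Fin.cons_zero, Pi.single_apply,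
          Prod.mk.injEq, ite_and]
        cases b 0 <;> simp
      · exact congrFun h3 i

/-- Nonnegative flows decompose into accepting runs. -/
theorem IsFlow.exists_decomposition {n : ℕ} {α : σ → ℝ} {y : Fin n → σ × Bool × σ → ℝ}
    (h : A.IsFlow n α y) (hα : ∀ q, 0 ≤ α q) (hy : ∀ i t, 0 ≤ y i t) :
    ∃ u : σ → Fin n → ℝ, (∀ q, 0 < α q → u q ∈ convexHull ℝ (A.wordVectors n q)) ∧
      ∑ q, α q • u q = flowValue n y := by
  induction n generalizing α with
  | zero =>
    refine ⟨0, fun q hq => subset_convexHull ℝ _ ⟨fun i => i.elim0, ?_, Subsingleton.elim _ _⟩,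
      Subsingleton.elim _ _⟩
    by_contra hacc
    exact hq.ne' (h q (by simpa [AcceptsWord] using hacc))
  | succ n ih =>
    obtain ⟨h1, h2, h3⟩ := h
    obtain ⟨u, hu, hsum⟩ := ih h3
      (fun q' => Finset.sum_nonneg fun q _ => Finset.sum_nonneg fun a _ => hy 0 _)
      (fun i t => hy i.succ t)
    let pt : Bool × σ → Fin (n + 1) → ℝ := fun t => Fin.cons (if t.1 then 1 else 0) (u t.2)
    -- Average the extended points with weights proportional to the flow leaving `q`. Only
    -- transitions with positive flow may enter the center of mass, as `u` is controlled only at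
    -- states receiving flow.
    refine ⟨fun q => (α q)⁻¹ • ∑ t : Bool × σ, y 0 (q, t) • pt t, fun q hq => ?_, ?_⟩
    · have := (convex_convexHull ℝ (A.wordVectors (n + 1) q)).centerMass_mem
        (t := Finset.univ.filter fun t : Bool × σ => 0 < y 0 (q, t))
        (w := fun t => y 0 (q, t)) (z := pt) (fun t _ => hy 0 _) ?_ ?_
      · rw [Finset.centerMass, Finset.sum_filter_of_ne, Finset.sum_filter_of_ne, h2] at this
        · exact this
        · exact fun t _ ht => (hy 0 _).lt_of_ne' fun h => ht (by simp [h])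
        · exact fun t _ ht => (hy 0 _).lt_of_ne' ht
      · rw [Finset.sum_filter_of_ne fun t _ ht => (hy 0 _).lt_of_ne' ht, h2]
        exact hq
      · rintro ⟨a, q'⟩ ht
        have ht : 0 < y 0 (q, a, q') := (Finset.mem_filter.1 ht).2
        refine cons_mem_convexHull_wordVectors (by_contra fun h => ht.ne' (h1 q a q' h))
          (hu q' (ht.trans_le ?_))
        exact (Finset.single_le_sum (f := fun a => y 0 (q, a, q')) (fun a _ => hy 0 _)
          (Finset.mem_univ a)).trans (Finset.single_le_sum
            (f := fun q => ∑ a, y 0 (q, a, q'))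
            (fun q _ => Finset.sum_nonneg fun a _ => hy 0 _) (Finset.mem_univ q))
    -- If `α q = 0`, nonnegativity makes all flow out of `q` vanish, so both sides are zero.
    · have hcancel : ∀ q, α q • (α q)⁻¹ • ∑ t : Bool × σ, y 0 (q, t) • pt t =
          ∑ t : Bool × σ, y 0 (q, t) • pt t := by
        intro q
        rcases (hα q).eq_or_lt with h0 | h0
        · have hz : ∀ t : Bool × σ, y 0 (q, t) = 0 := fun t =>
            (Finset.sum_eq_zero_iff_of_nonneg fun t _ => hy 0 (q, t)).1
              ((h2 q).trans h0.symm) t (Finset.mem_univ t)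
          simp [hz]
        · rw [smul_inv_smul₀ h0.ne']
      rw [Finset.sum_congr rfl fun q _ => hcancel q]
      funext i
      refine Fin.cases ?_ (fun i => ?_) i
      · simp [pt, flowValue, Fintype.sum_prod_type]
      · have := congrFun hsum i
        simp only [Finset.sum_apply, Pi.smul_apply, smul_eq_mul] at this
        refine Eq.trans ?_ this
        simp only [Finset.sum_apply, Pi.smul_apply, smul_eq_mul, pt, Fin.cons_succ,
          Fintype.sum_prod_type, Finset.sum_mul]
        symm
        rw [Finset.sum_comm]
        exact Finset.sum_congr rfl fun q _ => Finset.sum_comm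

end NFA

theorem Recognizable.exists_hasExtendedFormulation {L : Set (List Bool)} {N : ℕ}
    (h : Recognizable L N) (hN : 1 ≤ N) {n : ℕ} (hn : 1 ≤ n) :
    ∃ m ≤ 4 * N ^ 2 * n, HasExtendedFormulation (langPolytope L n) m := by
  classical
  obtain ⟨σ, _, A, hA, hL⟩ := h
  -- The parametrisation of an affine subspace needs a base point, so the empty polytope is treated
  -- apart.
  rcases Set.eq_empty_or_nonempty (langPolytope L n) with he | hne
  · rw [he]
    exact ⟨1, Nat.mul_pos (by positivity) hn, hasExtendedFormulation_empty n⟩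
  obtain ⟨_, b₀, hb₀, rfl⟩ := convexHull_nonempty_iff.1 hne
  let H : AffineSubspace ℝ ((σ → ℝ) × (Fin n → σ × Bool × σ → ℝ)) :=
    { carrier := {v | A.IsFlow n v.1 v.2 ∧ (∀ q, q ∉ A.start → v.1 q = 0) ∧ ∑ q, v.1 q = 1}
      smul_vsub_vadd_mem' := by
        rintro c u v w ⟨hu1, hu2, hu3⟩ ⟨hv1, hv2, hv3⟩ ⟨hw1, hw2, hw3⟩
        refine ⟨hu1.combo c hv1 hw1, fun q hq => ?_, ?_⟩
        · simp [hu2 q hq, hv2 q hq, hw2 q hq]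
        · simp [Finset.sum_add_distrib, ← Finset.mul_sum, Finset.sum_sub_distrib, hu3, hv3,
            hw3] }
  let l : ((σ → ℝ) × (Fin n → σ × Bool × σ → ℝ)) →ₗ[ℝ]
      (σ ⊕ (Fin n × σ × Bool × σ) → ℝ) :=
    { toFun := fun v => Sum.elim v.1 fun t => v.2 t.1 t.2
      map_add' := fun u v => by ext (i | i) <;> simp
      map_smul' := fun c v => by ext (i | i) <;> simp }
  let f : ((σ → ℝ) × (Fin n → σ × Bool × σ → ℝ)) →ₗ[ℝ] (Fin n → ℝ) := NFA.flowValue n ∘ₗ LinearMap.snd ℝ _ _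
  have hl : ∀ v, (∀ i, 0 ≤ l v i) ↔ (∀ q, 0 ≤ v.1 q) ∧ ∀ i t, 0 ≤ v.2 i t := fun v => by
    simp [l]
  have hword : ∀ b : Fin n → Bool, List.ofFn b ∈ L →
      ∃ v, (v ∈ H ∧ ∀ i, 0 ≤ l v i) ∧ f v = fun i => if b i then 1 else 0 := by
    intro b hb
    obtain ⟨q, hq, hb⟩ := (hL _).1 hb
    obtain ⟨y, h1, h2, h3⟩ := NFA.exists_isFlow_of_acceptsWord hb
    refine ⟨(Pi.single q 1, y), ⟨⟨h1, fun r hr => ?_, by simp⟩, (hl _).2 ⟨fun r => ?_, h2⟩⟩, h3⟩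
    · exact Pi.single_eq_of_ne (ne_of_mem_of_not_mem hq hr).symm 1
    · change 0 ≤ Pi.single (M := fun _ => ℝ) q 1 r
      rw [Pi.single_apply]
      split_ifs <;> simp
  have hconv : Convex ℝ {v | v ∈ H ∧ ∀ i, 0 ≤ l v i} := by
    have h1 : Convex ℝ {v | ∀ i, 0 ≤ l v i} := by
      intro u hu v hv r t hr ht _ i
      rw [map_add, map_smul, map_smul]
      exact add_nonneg (mul_nonneg hr (hu i)) (mul_nonneg ht (hv i))
    exact H.convex.inter h1
  have hbound : Bornology.IsBounded {v | v ∈ H ∧ ∀ i, 0 ≤ l v i} := by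
    refine (Metric.isBounded_Icc (0 : (σ → ℝ) × (Fin n → σ × Bool × σ → ℝ)) 1).subset ?_
    rintro v ⟨⟨h1, _, h3⟩, hv⟩
    obtain ⟨h4, h5⟩ := (hl v).1 hv
    refine ⟨⟨h4, h5⟩, fun q => ?_, fun i t => ?_⟩
    · exact (Finset.single_le_sum (fun q _ => h4 q) (Finset.mem_univ q)).trans_eq h3
    · exact (h1.le_sum h5 i t).trans_eq h3
  have himage : f '' {v | v ∈ H ∧ ∀ i, 0 ≤ l v i} = langPolytope L n := by
    apply Set.Subset.antisymm
    · rintro _ ⟨v, ⟨⟨h1, h2, h3⟩, hv⟩, rfl⟩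
      obtain ⟨h4, h5⟩ := (hl v).1 hv
      obtain ⟨u, hu, hsum⟩ := h1.exists_decomposition h4 h5
      have hpos : ∀ q, v.1 q ≠ 0 → 0 < v.1 q := fun q hq => (h4 q).lt_of_ne' hq
      -- The entering amounts are convex weights on the start states.
      have hmem := (convex_convexHull ℝ _).sum_mem (s := langPolytope L n)
        (t := Finset.univ.filter fun q => 0 < v.1 q) (w := v.1) (z := u) (fun q _ => h4 q)
        (by rw [Finset.sum_filter_of_ne fun q _ hq => hpos q hq, h3]) fun q hq => ?_
      · rw [Finset.sum_filter_of_ne fun q _ hq => hpos q fun h => hq (by simp [h]), hsum] at hmem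
        exact hmem
      · have hq : 0 < v.1 q := (Finset.mem_filter.1 hq).2
        refine convexHull_mono ?_ (hu q hq)
        rintro _ ⟨b, hb, rfl⟩
        exact ⟨b, (hL _).2 ⟨q, by_contra fun h => hq.ne' (h2 q h), hb⟩, rfl⟩
    · refine convexHull_min ?_ (hconv.linear_image f)
      rintro _ ⟨b, hb, rfl⟩
      exact hword b hb
  obtain ⟨v₀, hv₀, _⟩ := hword b₀ hb₀
  refine ⟨_, ?_, hasExtendedFormulation_of_affineSubspace H ⟨v₀, hv₀.1⟩ l f hbound himage⟩
  simp only [Fintype.card_sum, Fintype.card_prod, Fintype.card_fin, Fintype.card_bool]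
  calc Fintype.card σ + n * (Fintype.card σ * (2 * Fintype.card σ))
      ≤ N + n * (N * (2 * N)) := by gcongr
    _ ≤ 4 * N ^ 2 * n := by
        have h1 : 1 ≤ N * n := Nat.mul_pos hN hn
        nlinarith

theorem OnlineTM.RunsWithin.extensionComplexity_le {M : OnlineTM} {n p s c : ℕ}
    (hM : M.RunsWithin n p s) (hSym : Nat.card M.Sym ≤ c)
    (hState : Nat.card M.State ≤ 2 ^ (c * s)) {L : Language Bool}
    (hL : ∀ x : List Bool, x.length = n → (x ∈ L ↔ M.Accepts x)) (hn : 1 ≤ n) :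
    extensionComplexity (langPolytope L n) ≤ ((2 ^ ((8 * c + 10) * (p * s)) * n : ℕ) : ℕ∞) := by
  obtain ⟨hps, L', hL', hrec⟩ := hM.recognizable hSym hState
  obtain ⟨m, hm, hform⟩ := hrec.exists_hasExtendedFormulation Nat.one_le_two_pow hn
  have hP : langPolytope L n = langPolytope L' n := by
    unfold langPolytope
    refine congrArg _ (Set.ext fun v => exists_congr fun b => and_congr_left fun _ => ?_)
    exact (hL _ (by simp)).trans (hL' _ (by simp)).symm
  rw [hP]
  refine (iInf₂_le m hform).trans (Nat.cast_le.2 (hm.trans (Nat.mul_le_mul_right n ?_)))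
  calc 4 * (2 ^ ((4 * c + 4) * (p * s))) ^ 2 = 2 ^ (2 + (8 * c + 8) * (p * s)) := by
        rw [← pow_mul, pow_add]
        ring_nf
    -- Since `1 ≤ p * s`, the factor `4` is at most `2 ^ (2 * (p * s))`.
    _ ≤ 2 ^ ((8 * c + 10) * (p * s)) := Nat.pow_le_pow_right (by norm_num) (by nlinarith)

theorem mainTheorem2 :
    (∀ (p s : ℕ → ℕ) (L : Language Bool), L ∈ OnlineNSPACE p s →
      ∃ C n₀ : ℕ, ∀ n ≥ n₀,
        extensionComplexity (langPolytope L n) ≤ ((2 ^ (C * (p n * s n)) * n : ℕ) : ℕ∞)) ∧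
    (∀ (p s : ℕ → ℕ) (M : ℕ → OnlineTM) (c : ℕ),
      (∀ n, (M n).IsDeterministic) →
      (∀ n, (M n).RunsWithin n (p n) (s n)) →
      (∀ n, Nat.card (M n).Sym ≤ c) →
      (∀ n, Nat.card (M n).State ≤ 2 ^ (c * s n)) →
      ∃ C n₀ : ℕ, ∀ n ≥ n₀,
        extensionComplexity (langPolytope (familyLanguage M) n)
          ≤ ((2 ^ (C * (p n * s n)) * n : ℕ) : ℕ∞)) := by
  constructor
  · rintro p s L ⟨M, hM, hL⟩
    let c := max (Nat.card M.Sym) (Nat.card M.State)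
    -- At `n = 0` the right-hand side is `0`, hence `n₀ = 1`.
    refine ⟨8 * c + 10, 1, fun n hn =>
      (hM n).extensionComplexity_le (le_max_left _ _) ?_ (fun x _ => hL x) hn⟩
    have hs : 0 < s n :=
      Nat.zero_lt_of_lt ((hM n) (List.replicate n true) (by simp) _ .refl).2
    calc Nat.card M.State ≤ c := le_max_right _ _
      _ ≤ 2 ^ c := Nat.lt_two_pow_self.le
      _ ≤ 2 ^ (c * s n) := Nat.pow_le_pow_right (by norm_num) (Nat.le_mul_of_pos_right c hs)
  · intro p s M c _ hM hSym hState
    refine ⟨8 * c + 10, 1, fun n hn =>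
      (hM n).extensionComplexity_le (hSym n) (hState n) (fun x hx => ?_) hn⟩
    subst hx
    rfl
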